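/- Let $\mathfrak c=|\mathbb R|$. Suppose that $\mathbb R$ is not the union of any family of fewer than $\mathfrak c$ many meager subsets of $\mathbb R$. Then there exists a function $f\colon\mathbb R\to\mathbb R$ such that 1. $f$ is additive: $f(x+y)=f(x)+f(y)$ for all $x,y\in\mathbb R$; 2. $f$ is a connectivity function: for every connected set $Z\subseteq\mathbb R$, the graph $\{(x,f(x)) : x\in Z\}$ of the restriction $f|_Z$ is a connected subset of $Z\times\mathbb R$; 3. $f$ is not almost continuous in the sense of Stallings: it is not the case that every open set $U\subseteq\mathbb R\times\mathbb R$ containing the graph of $f$ contains the graph of some continuous function $g\colon\mathbb R\to\mathbb R$. -/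

import Mathlib

open Set
open scoped Cardinal

/-- A function `f : ℝ → ℝ` is additive if `f (x + y) = f x + f y` for all `x, y`. -/
def IsAdditiveFunction (f : ℝ → ℝ) : Prop :=
  ∀ x y : ℝ, f (x + y) = f x + f y

/-- A real-valued function `f` on a topological space `X` is a connectivity function if the graph
of its restriction to `Z` is connected for every connected `Z ⊆ X`. (The empty set counts as
connected; its graph is empty, so this is harmless. The topology that the graph over `Z` inherits
from `Z × ℝ` is the one it inherits from `X × ℝ`.) -/
def IsConnectivityFunction {X : Type*} [TopologicalSpace X] (f : X → ℝ) : Prop :=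
  ∀ Z : Set X, IsPreconnected Z → IsPreconnected (Z.graphOn f)

/-- A function `f : ℝ → ℝ` is almost continuous in the sense of Stallings if every open subset of
`ℝ × ℝ` containing the graph of `f` contains the graph of a continuous function `ℝ → ℝ`. -/
def IsAlmostContinuous (f : ℝ → ℝ) : Prop :=
  ∀ U : Set (ℝ × ℝ), IsOpen U → (univ : Set ℝ).graphOn f ⊆ U →
    ∃ g : ℝ → ℝ, Continuous g ∧ (univ : Set ℝ).graphOn g ⊆ U

/-! An additive function is a ℚ-subspace `Γ` of the plane that is a full graph; it is built by
recursion of length 𝔠. Almost continuity fails because `Γ` avoids the closed set `jumpWall r`: over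
(-1, 1) the wall runs from -∞ to ∞ with downward jumps only, so every continuous graph meets it
(`exists_graph_mem_jumpWall`). Connectivity holds because `Γ` meets every strip gap, i.e. whatever
two disjoint open sets leave over in a vertical strip that both meet.

The two demands conflict if a gap offers only points on affine copies of the wall. To prevent this,
`Γ` starts with a point inside each jump, and the jumps are dense. Suppose a gap missed by the
current `Γ`, of size < 𝔠, offered no usable point. Over each unused abscissa its fibre would be
closed of size < 𝔠, hence empty or with an isolated point. For a fixed copy and a fixed rational
window, isolated points occur only over a nowhere dense set, because such a gap cannot get past the
slit points (`isNowhereDense_uniqueGap`). By the covering hypothesis, fibres are empty over a dense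
set; connectedness of the interval then puts a whole vertical line into the gap, which is too large
(`exists_gap_point`). -/

section

open Filter Topology Cardinal

/-! ### Transfinite generation of subspaces, and their cardinalities -/

/-- An element of `N + span (p '' I)` already lies in `N`, or in `N + span {p i | i ≤ j}` for some
`j ∈ I`. -/
theorem Submodule.mem_sup_span_image_Iic {R M ι : Type*} [Ring R] [AddCommGroup M] [Module R M]
    [LinearOrder ι] (N : Submodule R M) (p : ι → M) (I : Set ι) {z : M}
    (hz : z ∈ N ⊔ Submodule.span R (p '' I)) :
    z ∈ N ∨ ∃ j ∈ I, z ∈ N ⊔ Submodule.span R (p '' Iic j) := by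
  obtain ⟨a, ha, b, hb, rfl⟩ := Submodule.mem_sup.1 hz
  have key : b = 0 ∨ ∃ j ∈ I, b ∈ Submodule.span R (p '' Iic j) := by
    clear hz
    induction hb using Submodule.span_induction with
    | mem x hx =>
      obtain ⟨j, hj, rfl⟩ := hx
      exact Or.inr ⟨j, hj, Submodule.subset_span ⟨j, le_refl j, rfl⟩⟩
    | zero => exact Or.inl rfl
    | add x y hx hy ihx ihy =>
      rcases ihx with rfl | ⟨j, hj, hxj⟩
      · simpa using ihy
      rcases ihy with rfl | ⟨k, hk, hyk⟩
      · exact Or.inr ⟨j, hj, by simpa using hxj⟩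
      have hmono : ∀ {u v : ι}, u ≤ v →
          Submodule.span R (p '' Iic u) ≤ Submodule.span R (p '' Iic v) := fun h =>
        Submodule.span_mono (image_mono (Iic_subset_Iic.2 h))
      rcases le_total j k with h | h
      · exact Or.inr ⟨k, hk, Submodule.add_mem _ (hmono h hxj) hyk⟩
      · exact Or.inr ⟨j, hj, Submodule.add_mem _ hxj (hmono h hyk)⟩
    | smul c x hx ih =>
      rcases ih with rfl | ⟨j, hj, hxj⟩
      · exact Or.inl (smul_zero c)
      · exact Or.inr ⟨j, hj, Submodule.smul_mem _ c hxj⟩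
  rcases key with rfl | ⟨j, hj, hb'⟩
  · exact Or.inl (by simpa using ha)
  · exact Or.inr ⟨j, hj, Submodule.add_mem _ (Submodule.mem_sup_left ha)
      (Submodule.mem_sup_right hb')⟩

/-- Transfinite construction of a submodule inside a set `A`: if, at every stage, a submodule
inside `A` can be enlarged by a generator taken from `D i`, then all the `D i` can be served. -/
theorem Submodule.exists_transfinite_generators {R M ι : Type*} [Ring R] [AddCommGroup M]
    [Module R M] [LinearOrder ι] [WellFoundedLT ι] (A : Set M) (N : Submodule R M)
    (D : ι → Set M) (hN : (N : Set M) ⊆ A)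
    (step : ∀ (i : ι) (p : ι → M), (∀ j < i, p j ∈ D j) →
      ((N ⊔ Submodule.span R (p '' Iio i) : Submodule R M) : Set M) ⊆ A →
      ∃ z ∈ D i,
        ((N ⊔ Submodule.span R (p '' Iio i) ⊔ Submodule.span R {z} : Submodule R M) : Set M)
          ⊆ A) :
    ∃ p : ι → M, (∀ i, p i ∈ D i) ∧
      ((N ⊔ Submodule.span R (range p) : Submodule R M) : Set M) ⊆ A := by
  classical
  let good : (i : ι) → (ι → M) → M → Prop := fun i p z => z ∈ D i ∧
    ((N ⊔ Submodule.span R (p '' Iio i) ⊔ Submodule.span R {z} : Submodule R M) : Set M) ⊆ A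
  let extend : (i : ι) → ((j : ι) → j < i → M) → ι → M := fun i h j =>
    if hj : j < i then h j hj else 0
  -- The default 0 is never used: `main` shows that every stage has a good candidate.
  let F : (i : ι) → ((j : ι) → j < i → M) → M := fun i h =>
    if hz : ∃ z, good i (extend i h) z then hz.choose else 0
  let p : ι → M := (wellFounded_lt (α := ι)).fix F
  have hp : ∀ i, p i = F i (fun j _ => p j) := fun i => (wellFounded_lt (α := ι)).fix_eq F i
  have himg : ∀ i, extend i (fun j _ => p j) '' Iio i = p '' Iio i := fun i =>
    image_congr fun j (hj : j < i) => by simp [extend, hj]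
  have hgood : ∀ i, (∃ z, good i p z) → good i p (p i) := by
    intro i hz
    have hz' : ∃ z, good i (extend i fun j _ => p j) z := by simpa only [good, himg] using hz
    have := hz'.choose_spec
    have hpi : p i = hz'.choose := by rw [hp i]; exact dif_pos hz'
    rw [← hpi] at this
    simpa only [good, himg] using this
  have hIic : ∀ i, (N ⊔ Submodule.span R (p '' Iic i) : Submodule R M) =
      N ⊔ Submodule.span R (p '' Iio i) ⊔ Submodule.span R {p i} := by
    intro i
    rw [sup_assoc, ← Submodule.span_union, ← image_singleton, ← image_union]
    congr 3
    ext j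
    simp [le_iff_lt_or_eq]
  have main : ∀ i, good i p (p i) := by
    intro i
    induction i using WellFoundedLT.induction with
    | ind i ih =>
    refine hgood i (step i p (fun j hj => (ih j hj).1) fun z hz => ?_)
    -- A combination of earlier generators involves a largest index `j`, so stage `j` already
    -- handled it.
    rcases N.mem_sup_span_image_Iic p _ hz with h | ⟨j, hj, h⟩
    · exact hN h
    · rw [hIic] at h
      exact (ih j hj).2 h
  refine ⟨p, fun i => (main i).1, fun z hz => ?_⟩
  rw [← image_univ] at hz
  rcases N.mem_sup_span_image_Iic p _ hz with h | ⟨j, -, h⟩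
  · exact hN h
  · rw [hIic] at h
    exact (main j).2 h

theorem Submodule.mk_span_rat_lt {M : Type} [AddCommGroup M] [Module ℚ M] (S : Set M)
    {κ : Cardinal} (hκ : ℵ₀ < κ) (hS : #S < κ) : #(Submodule.span ℚ S) < κ := by
  rcases S.eq_empty_or_nonempty with rfl | hne
  · rw [Submodule.span_empty]
    exact (mk_lt_aleph0 (α := (⊥ : Submodule ℚ M))).trans hκ
  have := hne.to_subtype
  have hsurj : #(Submodule.span ℚ S) ≤ #(S →₀ ℚ) := by
    have hr : LinearMap.range (Finsupp.linearCombination ℚ ((↑) : S → M)) =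
        Submodule.span ℚ S := by
      rw [Finsupp.range_linearCombination, Subtype.range_coe]
    rw [← hr]
    exact mk_le_of_surjective (LinearMap.surjective_rangeRestrict _)
  refine hsurj.trans_lt ?_
  rw [mk_finsupp_of_infinite']
  exact max_lt hS (by simpa using hκ)

theorem Submodule.mk_sup_rat_lt {M : Type} [AddCommGroup M] [Module ℚ M] (N : Submodule ℚ M)
    (S : Set M) {κ : Cardinal} (hκ : ℵ₀ < κ) (hN : #N < κ) (hS : #S < κ) :
    #(N ⊔ Submodule.span ℚ S : Submodule ℚ M) < κ := by
  have h : N ⊔ Submodule.span ℚ S = Submodule.span ℚ ((N : Set M) ∪ S) := by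
    rw [Submodule.span_union, Submodule.span_eq]
  rw [h]
  exact Submodule.mk_span_rat_lt _ hκ ((mk_union_le _ _).trans_lt (add_lt_of_lt hκ.le hN hS))

/-! ### Small closed sets and the covering hypothesis -/

/-- A nonempty closed set of fewer than continuum many reals has an isolated point. -/
theorem IsClosed.exists_isolated_of_mk_lt {C : Set ℝ} (hC : IsClosed C) (hne : C.Nonempty)
    (hcard : #C < 𝔠) : ∃ y ∈ C, ∃ c d : ℚ, (c : ℝ) < y ∧ y < d ∧ C ∩ Icc (c : ℝ) d = {y} := by
  by_contra hcon
  have hperf : Perfect C := by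
    refine ⟨hC, preperfect_iff_nhds.2 fun y hy U hU => ?_⟩
    by_contra! hU'
    obtain ⟨l, u, ⟨hl, hu⟩, hlu⟩ := mem_nhds_iff_exists_Ioo_subset.1 hU
    obtain ⟨c, hc, hcy⟩ := exists_rat_btwn hl
    obtain ⟨d, hyd, hd⟩ := exists_rat_btwn hu
    refine hcon ⟨y, hy, c, d, hcy, hyd, ?_⟩
    ext z
    simp only [mem_inter_iff, mem_Icc, mem_singleton_iff]
    constructor
    · rintro ⟨hz, h1, h2⟩
      exact hU' z ⟨hlu ⟨hc.trans_le h1, h2.trans_lt hd⟩, hz⟩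
    · rintro rfl
      exact ⟨hy, hcy.le, hyd.le⟩
  obtain ⟨f, hf, -, hinj⟩ := hperf.exists_nat_bool_injection hne
  have : #(ℕ → Bool) ≤ #C :=
    mk_le_of_injective (f := fun x => (⟨f x, hf (mem_range_self x)⟩ : C))
      fun x y h => hinj (congrArg Subtype.val h)
  have h2 : #(ℕ → Bool) = 𝔠 := by simp
  rw [h2] at this
  exact this.not_gt hcard

/-- If `ℝ` is not the union of fewer than continuum many meagre sets, then neither is it possible
to cover an open interval by fewer than continuum many nowhere dense sets. -/
theorem exists_mem_Ioo_forall_notMem_of_isNowhereDense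
    (hcov : ¬ ∃ 𝓜 : Set (Set ℝ), #𝓜 < 𝔠 ∧ (∀ A ∈ 𝓜, IsMeagre A) ∧ ⋃₀ 𝓜 = Set.univ)
    {ι : Type} (hι : #ι < 𝔠) (A : ι → Set ℝ) (hA : ∀ i, IsNowhereDense (A i))
    {a b : ℝ} (hab : a < b) : ∃ x ∈ Ioo a b, ∀ i, x ∉ A i := by
  by_contra! hcon
  -- Rational translates of (a, b) cover ℝ, so a small cover of (a, b) spreads to a small cover of
  -- ℝ.
  refine hcov ⟨range fun z : ℚ × ι => (fun x => (z.1 : ℝ) + x) '' A z.2, ?_, ?_, ?_⟩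
  · refine mk_range_le.trans_lt ?_
    rw [mk_prod, lift_id, lift_id]
    exact mul_lt_of_lt aleph0_le_continuum (by simpa using aleph0_lt_continuum) hι
  · rintro _ ⟨⟨q, i⟩, rfl⟩
    exact ((Homeomorph.addLeft (q : ℝ)).isInducing.isNowhereDense_image (hA i)).isMeagre
  · refine eq_univ_of_forall fun x => ?_
    obtain ⟨q, hq1, hq2⟩ := exists_rat_btwn (show x - b < x - a by linarith)
    obtain ⟨i, hi⟩ := hcon (x - q) ⟨by linarith, by linarith⟩
    exact ⟨_, ⟨(q, i), rfl⟩, x - q, hi, by ring⟩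

/-! ### Monotone functions with prescribed jumps -/

/-- The mass of a set of natural numbers, where `n` has mass `2⁻ⁿ`. -/
noncomputable def geometricMass (S : Set ℕ) : ℝ :=
  ∑' n, S.indicator (fun n => (1 / 2 : ℝ) ^ n) n

theorem summable_geometricMass (S : Set ℕ) :
    Summable (S.indicator fun n => (1 / 2 : ℝ) ^ n) :=
  summable_geometric_two.indicator S

theorem geometricMass_lt {S T : Set ℕ} (h : S ⊆ T) {n : ℕ} (hn : n ∈ T) (hn' : n ∉ S) :
    geometricMass S < geometricMass T := by
  refine Summable.tsum_lt_tsum (i := n)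
    (fun k => indicator_le_indicator_of_subset h (fun k => by positivity) k) ?_
    (summable_geometricMass S) (summable_geometricMass T)
  rw [indicator_of_mem hn, indicator_of_notMem hn']
  positivity

theorem geometricMass_mono {S T : Set ℕ} (h : S ⊆ T) : geometricMass S ≤ geometricMass T :=
  Summable.tsum_le_tsum
    (fun k => indicator_le_indicator_of_subset h (fun k => by positivity) k)
    (summable_geometricMass S) (summable_geometricMass T)

theorem tendsto_geometricMass {α : Type*} {F : Filter α} {S : α → Set ℕ} {T : Set ℕ}
    (h : ∀ n, ∀ᶠ s in F, (n ∈ S s ↔ n ∈ T)) :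
    Tendsto (fun s => geometricMass (S s)) F (𝓝 (geometricMass T)) := by
  refine tendsto_tsum_of_dominated_convergence summable_geometric_two (fun n => ?_)
    (Eventually.of_forall fun s n => ?_)
  · refine tendsto_const_nhds.congr' ?_
    filter_upwards [h n] with s hs
    by_cases hn : n ∈ T
    · rw [indicator_of_mem hn, indicator_of_mem (hs.2 hn)]
    · rw [indicator_of_notMem hn, indicator_of_notMem fun h' => hn (hs.1 h')]
  · rw [norm_indicator_eq_indicator_norm]
    refine (indicator_le_self' (fun k _ => norm_nonneg _) n).trans ?_
    simp

/-- The left-continuous increasing function with jump `2⁻ⁿ` at `r n`. -/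
noncomputable def jumpLeft (r : ℕ → ℝ) (t : ℝ) : ℝ := geometricMass {n | r n < t}

/-- The right-continuous increasing function with jump `2⁻ⁿ` at `r n`. -/
noncomputable def jumpRight (r : ℕ → ℝ) (t : ℝ) : ℝ := geometricMass {n | r n ≤ t}

section Jump

variable (r : ℕ → ℝ) (t : ℝ)

theorem jumpLeft_le_jumpRight : jumpLeft r t ≤ jumpRight r t :=
  geometricMass_mono fun n (h : r n < t) => h.le

theorem jumpLeft_lt_jumpRight (n : ℕ) : jumpLeft r (r n) < jumpRight r (r n) :=
  geometricMass_lt (fun k (h : r k < r n) => h.le) (n := n) (le_refl (r n)) (lt_irrefl (r n))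

theorem tendsto_jumpLeft_left : Tendsto (jumpLeft r) (𝓝[<] t) (𝓝 (jumpLeft r t)) := by
  refine tendsto_geometricMass fun n => ?_
  by_cases hn : r n < t
  · filter_upwards [Ioo_mem_nhdsLT hn] with s hs
    simp [hn, hs.1]
  · filter_upwards [self_mem_nhdsWithin] with s hs
    have hs : s < t := hs
    simp only [hn, iff_false, not_lt]
    linarith [not_lt.1 hn]

theorem tendsto_jumpRight_left : Tendsto (jumpRight r) (𝓝[<] t) (𝓝 (jumpLeft r t)) := by
  refine tendsto_geometricMass fun n => ?_
  by_cases hn : r n < t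
  · filter_upwards [Ioo_mem_nhdsLT hn] with s hs
    simp [hn, hs.1.le]
  · filter_upwards [self_mem_nhdsWithin] with s hs
    have hs : s < t := hs
    simp only [hn, iff_false, not_le]
    linarith [not_lt.1 hn]

theorem tendsto_jumpLeft_right : Tendsto (jumpLeft r) (𝓝[>] t) (𝓝 (jumpRight r t)) := by
  refine tendsto_geometricMass fun n => ?_
  by_cases hn : r n ≤ t
  · filter_upwards [self_mem_nhdsWithin] with s hs
    have hs : t < s := hs
    simp only [hn, iff_true]
    linarith
  · filter_upwards [Ioo_mem_nhdsGT (not_le.1 hn)] with s hs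
    simp [hn, hs.2.le]

theorem tendsto_jumpRight_right : Tendsto (jumpRight r) (𝓝[>] t) (𝓝 (jumpRight r t)) := by
  refine tendsto_geometricMass fun n => ?_
  by_cases hn : r n ≤ t
  · filter_upwards [self_mem_nhdsWithin] with s hs
    have hs : t < s := hs
    simp only [hn, iff_true]
    linarith
  · filter_upwards [Ioo_mem_nhdsGT (not_le.1 hn)] with s hs
    simp [hn, hs.2]

end Jump

/-! ### The wall and its slits -/

/-- A left-continuous function all of whose jumps go up has no sign change from `+` to `-` without
a zero. -/
theorem exists_eq_zero_of_tendsto_left_of_jumps_up {L R : ℝ → ℝ} {a b : ℝ} (hab : a ≤ b)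
    (hleft : ∀ t, Tendsto L (𝓝[<] t) (𝓝 (L t))) (hright : ∀ t, Tendsto L (𝓝[>] t) (𝓝 (R t)))
    (hLR : ∀ t ∈ Icc a b, L t ≤ R t) (ha : 0 < L a) (hb : L b < 0) :
    ∃ t ∈ Icc a b, L t = 0 := by
  by_contra! hL0
  obtain ⟨t₀, ht₀⟩ : ∃ t₀, IsGLB {t | t ∈ Icc a b ∧ L t < 0} t₀ :=
    ⟨_, isGLB_csInf ⟨b, ⟨hab, le_rfl⟩, hb⟩ ⟨a, fun t ht => ht.1.1⟩⟩
  have ht₀mem : t₀ ∈ Icc a b := ⟨ht₀.2 fun t ht => ht.1.1, ht₀.1 ⟨⟨hab, le_rfl⟩, hb⟩⟩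
  have hbelow : ∀ t ∈ Ico a t₀, 0 ≤ L t := fun t ht => by
    by_contra! h
    exact ht.2.not_ge (ht₀.1 ⟨⟨ht.1, ht.2.le.trans ht₀mem.2⟩, h⟩)
  have hpos : 0 < L t₀ := by
    refine lt_of_le_of_ne ?_ (hL0 _ ht₀mem).symm
    rcases ht₀mem.1.eq_or_lt with h | h
    · rw [← h]
      exact ha.le
    · refine ge_of_tendsto (hleft t₀) ?_
      filter_upwards [Ioo_mem_nhdsLT h] with s hs
      exact hbelow s ⟨hs.1.le, hs.2⟩
  -- The right limit at the infimum `t₀` is at least `L t₀ > 0`, so negative values cannot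
  -- accumulate at `t₀` from the right.
  have hev : ∀ᶠ s in 𝓝[>] t₀, 0 < L s :=
    (hright t₀).eventually_const_lt (hpos.trans_le (hLR _ ht₀mem))
  obtain ⟨u, hu, hu'⟩ := (mem_nhdsGT_iff_exists_Ioo_subset).1 hev
  obtain ⟨t, ht, hle, htu⟩ := ht₀.exists_between hu
  rcases hle.eq_or_lt with h | h
  · rw [← h] at ht
    exact hpos.not_gt ht.2
  · have h' : 0 < L t := hu' ⟨h, htu⟩
    exact h'.not_gt ht.2

/-- For `t ∈ (-1, 1)` this vanishes iff `p.2 = 2 t / (1 - t ^ 2) - z`, where `t = p.1`. -/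
def wallEquation (p : ℝ × ℝ) (z : ℝ) : ℝ := (1 - p.1 ^ 2) * (p.2 + z) - 2 * p.1

/-- The closure of the graph of the function `t ↦ 2 t / (1 - t ^ 2) - jumpLeft r t` on `(-1, 1)`,
which goes from `-∞` to `∞` and has a downward jump at each `r n`. -/
def jumpWall (r : ℕ → ℝ) : Set (ℝ × ℝ) :=
  {p | p.1 ^ 2 ≤ 1 ∧
    (wallEquation p (jumpLeft r p.1) = 0 ∨ wallEquation p (jumpRight r p.1) = 0)}

theorem continuous_wallEquation :
    Continuous fun x : (ℝ × ℝ) × ℝ => wallEquation x.1 x.2 := by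
  unfold wallEquation
  fun_prop

section Wall

variable {r : ℕ → ℝ}

theorem sq_lt_one_of_mem_jumpWall {p : ℝ × ℝ} (hp : p ∈ jumpWall r) : p.1 ^ 2 < 1 := by
  refine lt_of_le_of_ne hp.1 fun h => ?_
  have h0 : p.1 = 0 := by
    rcases hp.2 with h' | h' <;>
    · simp only [wallEquation, h] at h'
      linarith
  simp [h0] at h

theorem eq_of_mem_jumpWall {p : ℝ × ℝ} (hp : p ∈ jumpWall r) :
    p.2 = 2 * p.1 / (1 - p.1 ^ 2) - jumpLeft r p.1 ∨
      p.2 = 2 * p.1 / (1 - p.1 ^ 2) - jumpRight r p.1 := by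
  have h0 : 1 - p.1 ^ 2 ≠ 0 := by linarith [sq_lt_one_of_mem_jumpWall hp]
  rcases hp.2 with h | h
  · left
    rw [wallEquation] at h
    field_simp
    linarith
  · right
    rw [wallEquation] at h
    field_simp
    linarith

theorem countable_section_jumpWall (r : ℕ → ℝ) (x : ℝ) : {y | (x, y) ∈ jumpWall r}.Countable := by
  refine ((countable_singleton (2 * x / (1 - x ^ 2) - jumpRight r x)).insert
    (2 * x / (1 - x ^ 2) - jumpLeft r x)).mono fun y hy => ?_
  exact eq_of_mem_jumpWall hy

/-- Both jump functions tend to `jumpLeft` from the left and to `jumpRight` from the right, the two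
values allowed over the limit abscissa. Clearing the denominator keeps the equation continuous at
±1, where it has no solution. -/
theorem isClosed_jumpWall (r : ℕ → ℝ) : IsClosed (jumpWall r) := by
  rw [← isOpen_compl_iff, isOpen_iff_mem_nhds]
  intro p hp
  by_cases h1 : p.1 ^ 2 ≤ 1
  swap
  · have : ∀ᶠ q : ℝ × ℝ in 𝓝 p, 1 < q.1 ^ 2 :=
      (by fun_prop : Continuous fun q : ℝ × ℝ => q.1 ^ 2).continuousAt.eventually_const_lt
        (not_le.1 h1)
    filter_upwards [this] with q hq hq'
    exact hq.not_ge hq'.1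
  have hne : ∀ z, wallEquation p z ≠ 0 → ∀ᶠ x : (ℝ × ℝ) × ℝ in 𝓝 p ×ˢ 𝓝 z,
      wallEquation x.1 x.2 ≠ 0 := fun z hz => by
    rw [← nhds_prod_eq]
    exact continuous_wallEquation.continuousAt.eventually_ne hz
  have hp' := not_and.1 hp h1
  obtain ⟨P, hP, V, hV, hPV⟩ := eventually_prod_iff.1 (hne _ fun h => hp' (Or.inl h))
  obtain ⟨Q, hQ, W, hW, hQW⟩ := eventually_prod_iff.1 (hne _ fun h => hp' (Or.inr h))
  have hnear : ∀ᶠ t in 𝓝 p.1, (V (jumpLeft r t) ∨ W (jumpLeft r t)) ∧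
      (V (jumpRight r t) ∨ W (jumpRight r t)) := by
    rw [← nhdsNE_sup_pure, ← nhdsLT_sup_nhdsGT, eventually_sup, eventually_sup]
    refine ⟨⟨?_, ?_⟩, ?_⟩
    · filter_upwards [tendsto_jumpLeft_left r p.1 hV, tendsto_jumpRight_left r p.1 hV] with t h h'
      exact ⟨Or.inl h, Or.inl h'⟩
    · filter_upwards [tendsto_jumpLeft_right r p.1 hW, tendsto_jumpRight_right r p.1 hW]
        with t h h'
      exact ⟨Or.inr h, Or.inr h'⟩
    · exact ⟨Or.inl hV.self_of_nhds, Or.inr hW.self_of_nhds⟩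
  filter_upwards [hP, hQ, continuous_fst.continuousAt.eventually hnear] with q hPq hQq hq hqK
  rcases hqK.2 with h | h
  · exact hq.1.elim (fun h' => hPV hPq h' h) fun h' => hQW hQq h' h
  · exact hq.2.elim (fun h' => hPV hPq h' h) fun h' => hQW hQq h' h

/-- Along the graph, `wallEquation` with `jumpLeft` is 2 at -1 and -2 at 1, and on [-1, 1] its jumps
go up because `1 - t ^ 2 ≥ 0`. -/
theorem exists_graph_mem_jumpWall (r : ℕ → ℝ) {g : ℝ → ℝ} (hg : Continuous g) :
    ∃ t, (t, g t) ∈ jumpWall r := by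
  have hsq : ∀ t : ℝ, t ∈ Icc (-1 : ℝ) 1 → t ^ 2 ≤ 1 := fun t ht => by
    rw [sq_le_one_iff_abs_le_one, abs_le]
    exact ht
  have hlim : ∀ (F : Filter ℝ) (t z : ℝ), F ≤ 𝓝 t → Tendsto (jumpLeft r) F (𝓝 z) →
      Tendsto (fun s => wallEquation (s, g s) (jumpLeft r s)) F
        (𝓝 (wallEquation (t, g t) z)) := fun F t z hF hz => by
    have hid : Tendsto (fun s : ℝ => s) F (𝓝 t) := hF
    have hgt : Tendsto g F (𝓝 (g t)) := (hg.tendsto t).mono_left hF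
    simp only [wallEquation]
    exact ((tendsto_const_nhds.sub (hid.pow 2)).mul (hgt.add hz)).sub (hid.const_mul 2)
  have hLR : ∀ t ∈ Icc (-1 : ℝ) 1,
      wallEquation (t, g t) (jumpLeft r t) ≤ wallEquation (t, g t) (jumpRight r t) :=
    fun t ht => by
      simp only [wallEquation]
      have := mul_le_mul_of_nonneg_left (jumpLeft_le_jumpRight r t) (sub_nonneg.2 (hsq t ht))
      linarith
  obtain ⟨t, ht, h0⟩ := exists_eq_zero_of_tendsto_left_of_jumps_up (by norm_num)
    (fun t => hlim _ _ _ nhdsWithin_le_nhds (tendsto_jumpLeft_left r t))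
    (fun t => hlim _ _ _ nhdsWithin_le_nhds (tendsto_jumpLeft_right r t)) hLR
    (by norm_num [wallEquation]) (by norm_num [wallEquation])
  exact ⟨t, hsq t ht, Or.inl h0⟩

/-- The possible heights of a point over `r n` that lies strictly inside the jump. -/
def slit (r : ℕ → ℝ) (n : ℕ) : Set ℝ :=
  Ioo (2 * r n / (1 - r n ^ 2) - jumpRight r (r n)) (2 * r n / (1 - r n ^ 2) - jumpLeft r (r n))

theorem mk_slit (r : ℕ → ℝ) (n : ℕ) : #(slit r n) = 𝔠 :=
  mk_Ioo_real (sub_lt_sub_left (jumpLeft_lt_jumpRight r n) _)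

/-- Both branches of the wall tend to the top of the slit from the left and to its bottom from the
right. -/
theorem slit_separates {n : ℕ} (hn : r n ^ 2 < 1) {y : ℝ} (hy : y ∈ slit r n) :
    (∀ᶠ t in 𝓝[<] r n, ∀ y', (t, y') ∈ jumpWall r → y < y') ∧
      ∀ᶠ t in 𝓝[>] r n, ∀ y', (t, y') ∈ jumpWall r → y' < y := by
  have hc : ContinuousAt (fun t : ℝ => 2 * t / (1 - t ^ 2)) (r n) := by
    refine ContinuousAt.div (by fun_prop) (by fun_prop) ?_
    linarith
  constructor
  · filter_upwards [((hc.tendsto.mono_left nhdsWithin_le_nhds).sub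
        (tendsto_jumpLeft_left r (r n))).eventually_const_lt hy.2,
      ((hc.tendsto.mono_left nhdsWithin_le_nhds).sub
        (tendsto_jumpRight_left r (r n))).eventually_const_lt hy.2] with t h1 h2 y' hy'
    rcases eq_of_mem_jumpWall hy' with h | h
    · exact h1.trans_eq h.symm
    · exact h2.trans_eq h.symm
  · filter_upwards [((hc.tendsto.mono_left nhdsWithin_le_nhds).sub
        (tendsto_jumpLeft_right r (r n))).eventually_lt_const hy.1,
      ((hc.tendsto.mono_left nhdsWithin_le_nhds).sub
        (tendsto_jumpRight_right r (r n))).eventually_lt_const hy.1] with t h1 h2 y' hy'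
    rcases eq_of_mem_jumpWall hy' with h | h
    · exact h.trans_lt h1
    · exact h.trans_lt h2

/-- Some `r n` is negative, so both jump functions are positive at 0. -/
theorem zero_notMem_jumpWall (hr : DenseRange r) : (0 : ℝ × ℝ) ∉ jumpWall r := by
  obtain ⟨n, hn⟩ := hr.exists_mem_open isOpen_Iio (⟨-1, by norm_num⟩ : (Iio (0 : ℝ)).Nonempty)
  have hpos : 0 < jumpLeft r 0 := by
    have := geometricMass_lt (empty_subset {n | r n < 0}) (n := n) hn (notMem_empty n)
    rwa [show geometricMass ∅ = 0 by simp [geometricMass]] at this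
  have hpos' := hpos.trans_le (jumpLeft_le_jumpRight r 0)
  rintro ⟨-, h | h⟩
  · simp [wallEquation, hpos.ne'] at h
  · simp [wallEquation, hpos'.ne'] at h

/-- Near each point of the wall there are slits. -/
theorem exists_slit_of_mem_jumpWall (hr : DenseRange r) {O : Set ℝ} (hO : IsOpen O)
    {p : ℝ × ℝ} (hp : p ∈ jumpWall r) (hpO : p.1 ∈ O) : ∃ n, r n ∈ O ∧ r n ^ 2 < 1 := by
  have hopen : IsOpen (O ∩ {t : ℝ | t ^ 2 < 1}) :=
    hO.inter (isOpen_lt (by fun_prop) continuous_const)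
  exact hr.exists_mem_open hopen ⟨p.1, hpO, sq_lt_one_of_mem_jumpWall hp⟩

end Wall

/-! ### A dense independent sequence, and a cardinal bound -/

/-- There is a dense sequence of reals that is linearly independent over `ℚ`. -/
theorem exists_denseRange_linearIndependent_rat :
    ∃ r : ℕ → ℝ, DenseRange r ∧ LinearIndependent ℚ r := by
  let B := Module.Basis.ofVectorSpace ℚ ℝ
  have hinf : Infinite (Module.Basis.ofVectorSpaceIndex ℚ ℝ) := by
    rw [infinite_iff, B.mk_eq_rank'', Real.rank_rat_real]
    exact aleph0_le_continuum
  let e := Infinite.natEmbedding (Module.Basis.ofVectorSpaceIndex ℚ ℝ)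
  have he : LinearIndependent ℚ fun n => B (e n) := B.linearIndependent.comp e e.injective
  obtain ⟨x, hx⟩ := TopologicalSpace.exists_dense_seq ℝ
  -- Nonzero rational scaling preserves independence; `n` encodes a target point and a precision.
  have hscale : ∀ n : ℕ, ∃ q : ℚ, q ≠ 0 ∧
      dist ((q : ℝ) * B (e n)) (x n.unpair.1) < 1 / ((n.unpair.2 : ℝ) + 1) := by
    intro n
    have hne : B (e n) ≠ 0 := B.ne_zero _
    have hdense : DenseRange fun q : ℚ => (q : ℝ) * B (e n) :=
      ((Homeomorph.mulRight₀ _ hne).surjective.denseRange).comp Rat.denseRange_cast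
        (Homeomorph.mulRight₀ _ hne).continuous
    obtain ⟨z, hz0, hz⟩ := (dense_compl_singleton (0 : ℝ)).exists_mem_open
      (Metric.isOpen_ball (x := x n.unpair.1) (ε := 1 / ((n.unpair.2 : ℝ) + 1)))
      ⟨_, Metric.mem_ball_self (by positivity)⟩
    obtain ⟨q, hq, hq0⟩ := hdense.exists_mem_open
      (Metric.isOpen_ball.inter (isOpen_compl_singleton (x := (0 : ℝ)))) ⟨z, hz, hz0⟩
    refine ⟨q, ?_, hq⟩
    rintro rfl
    simp at hq0
  choose q hq0 hq using hscale
  refine ⟨fun n => q n * B (e n), ?_, ?_⟩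
  · rw [Metric.denseRange_iff]
    intro y ε hε
    obtain ⟨m, hm⟩ := Metric.denseRange_iff.1 hx y (ε / 2) (half_pos hε)
    obtain ⟨k, hk⟩ := exists_nat_one_div_lt (half_pos hε)
    refine ⟨Nat.pair m k, ?_⟩
    have h := hq (Nat.pair m k)
    rw [Nat.unpair_pair] at h
    calc dist y _ ≤ dist y (x m) + dist (x m) _ := dist_triangle _ _ _
      _ < ε := by rw [dist_comm (x m)]; linarith
  · have := he.units_smul fun n => Units.mk0 (q n) (hq0 n)
    convert this using 2 with n
    simp [Units.smul_def, Rat.smul_def]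

theorem Cardinal.mk_iUnion_lt_continuum_of_countable {α ι : Type} (hι : #ι < 𝔠) (A : ι → Set α)
    (hA : ∀ i, (A i).Countable) : #(⋃ i, A i) < 𝔠 := by
  refine (mk_iUnion_le A).trans_lt (mul_lt_of_lt aleph0_le_continuum hι ?_)
  exact (ciSup_le' fun i => le_aleph0_iff_set_countable.2 (hA i)).trans_lt aleph0_lt_continuum

/-! ### Two disjoint open sets along vertical segments -/

section Separation

variable {U V : Set (ℝ × ℝ)}

/-- A vertical segment inside the union of two disjoint open sets lies in one of them. -/
theorem vertical_subset_left (hU : IsOpen U) (hV : IsOpen V) (hUV : Disjoint U V) {x z : ℝ}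
    {S : Set ℝ} (hS : IsPreconnected S) (hz : z ∈ S) (hxz : (x, z) ∈ U)
    (hSUV : ∀ s ∈ S, (x, s) ∈ U ∪ V) {s : ℝ} (hs : s ∈ S) : (x, s) ∈ U := by
  have hcont : Continuous fun s : ℝ => (x, s) := by fun_prop
  exact hS.subset_left_of_subset_union (hU.preimage hcont) (hV.preimage hcont)
    (hUV.preimage _) hSUV ⟨z, hz, hxz⟩ hs

/-- The abscissae over which, between the heights `c` and `d`, the complement of `U ∪ V` is a
single point and this point satisfies `P`. -/
def uniqueGap (U V : Set (ℝ × ℝ)) (P : Set (ℝ × ℝ)) (c d : ℝ) : Set ℝ :=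
  {x | ∃ y ∈ Ioo c d, (x, y) ∈ P ∧ {s | (x, s) ∉ U ∪ V} ∩ Icc c d = {y}}

theorem mem_left_of_uniqueGap (hU : IsOpen U) (hV : IsOpen V) (hUV : Disjoint U V) {c d x y : ℝ}
    (hgap : {s | (x, s) ∉ U ∪ V} ∩ Icc c d = {y}) :
    (∀ z ∈ Ioc y d, (x, z) ∈ U → ∀ s ∈ Ioc y d, (x, s) ∈ U) ∧
      ∀ z ∈ Ico c y, (x, z) ∈ U → ∀ s ∈ Ico c y, (x, s) ∈ U := by
  have hmem : y ∈ Icc c d := (hgap.symm ▸ mem_singleton y :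
    y ∈ {s | (x, s) ∉ U ∪ V} ∩ Icc c d).2
  have hcov : ∀ s ∈ Icc c d, s ≠ y → (x, s) ∈ U ∪ V := fun s hs hsy => by
    by_contra h
    exact hsy (hgap.subset ⟨h, hs⟩)
  exact ⟨fun z hz hzU s hs => vertical_subset_left hU hV hUV isPreconnected_Ioc hz hzU
      (fun s hs => hcov s ⟨hmem.1.trans hs.1.le, hs.2⟩ hs.1.ne') hs,
    fun z hz hzU s hs => vertical_subset_left hU hV hUV isPreconnected_Ico hz hzU
      (fun s hs => hcov s ⟨hs.1, hs.2.le.trans hmem.2⟩ hs.2.ne) hs⟩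

/-- If densely many vertical segments over `J` meet the complement of `U ∪ V` in one point only, and
their ends are in `U`, then the points of `J × (c, d)` are not in the closure of `V`. -/
theorem notMem_closure_of_dense_uniqueGap (hU : IsOpen U) (hV : IsOpen V) (hUV : Disjoint U V)
    {c d : ℝ} {P : Set (ℝ × ℝ)} {J : Set ℝ} (hJ : IsOpen J)
    (hdense : J ⊆ closure (uniqueGap U V P c d)) (hc : ∀ x ∈ J, (x, c) ∈ U)
    (hd : ∀ x ∈ J, (x, d) ∈ U) {p : ℝ × ℝ} (hpJ : p.1 ∈ J) (hp : p.2 ∈ Ioo c d) :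
    p ∉ closure V := by
  intro hpV
  obtain ⟨p', ⟨hp'J, hp'⟩, hp'V⟩ := mem_closure_iff.1 hpV (J ×ˢ Ioo c d) (hJ.prod isOpen_Ioo)
    ⟨hpJ, hp⟩
  have hopen : IsOpen (V ∩ J ×ˢ Ioo c d) := hV.inter (hJ.prod isOpen_Ioo)
  obtain ⟨O, O', hO, hO', hpO, hpO', hsub⟩ := isOpen_prod_iff.1 hopen p'.1 p'.2
    ⟨hp'V, hp'J, hp'⟩
  obtain ⟨x, hxO, y, hy, -, hgap⟩ := mem_closure_iff.1 (hdense hp'J) O hO hpO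
  -- Avoiding height `y` leaves a point of `V` on a gap-free segment with one end in `U`.
  obtain ⟨s, hsy, hs⟩ := (dense_compl_singleton y).exists_mem_open hO' ⟨_, hpO'⟩
  have hxs : (x, s) ∈ V ∩ J ×ˢ Ioo c d := hsub ⟨hxO, hs⟩
  have hxJ : x ∈ J := hxs.2.1
  have hscd : s ∈ Ioo c d := hxs.2.2
  have hmem := mem_left_of_uniqueGap hU hV hUV hgap
  refine disjoint_left.1 hUV ?_ hxs.1
  rcases lt_or_gt_of_ne hsy with h | h
  · exact hmem.2 c ⟨le_rfl, hy.1⟩ (hc x hxJ) s ⟨hscd.1.le, h⟩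
  · exact hmem.1 d ⟨hy.2, le_rfl⟩ (hd x hxJ) s ⟨h, hscd.2.le⟩

/-- The slits of an affine copy of the wall prevent the wall from containing the boundary between
`U` and `V` over a dense set of abscissae. -/
theorem isNowhereDense_uniqueGap (hU : IsOpen U) (hV : IsOpen V) (hUV : Disjoint U V)
    {r : ℕ → ℝ} (hr : DenseRange r) (Γ : Submodule ℚ (ℝ × ℝ))
    (hslit : ∀ n, ∃ y ∈ slit r n, (r n, y) ∈ Γ) {I : Set ℝ} (hI : IsOpen I)
    (hreg : ∀ p : ℝ × ℝ, p.1 ∈ I → p ∉ U ∪ V → p ∈ closure U ∧ p ∈ closure V)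
    (hΓ : ∀ p ∈ Γ, p.1 ∈ I → p ∈ U ∪ V) {q : ℚ} (hq : q ≠ 0) {v : ℝ × ℝ} (hv : v ∈ Γ) (c d : ℝ) :
    IsNowhereDense (uniqueGap U V {p | p.1 ∈ I ∧ q • p + v ∈ jumpWall r} c d) := by
  set X := uniqueGap U V {p | p.1 ∈ I ∧ q • p + v ∈ jumpWall r} c d with hX
  by_contra hcon
  have hqR : (q : ℝ) ≠ 0 := by exact_mod_cast hq
  obtain ⟨z, hz⟩ := nonempty_iff_ne_empty.2 hcon
  obtain ⟨x₀, hx₀W, hx₀X⟩ := mem_closure_iff.1 (interior_subset hz) _ isOpen_interior hz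
  obtain ⟨y₀, hy₀, ⟨hx₀I, hwall⟩, hgap₀⟩ := hx₀X
  have hy₀mem : y₀ ∈ {s | (x₀, s) ∉ U ∪ V} ∩ Icc c d := hgap₀.symm ▸ mem_singleton y₀
  have hcd : c < d := hy₀.1.trans hy₀.2
  have hends : ∀ s ∈ Icc c d, s ≠ y₀ → ∃ C : Set (ℝ × ℝ), (C = U ∨ C = V) ∧ (x₀, s) ∈ C :=
    fun s hs hsy => by
      have : (x₀, s) ∈ U ∪ V := by
        by_contra h
        exact hsy (hgap₀.subset ⟨h, hs⟩)
      exact this.elim (fun h => ⟨U, Or.inl rfl, h⟩) fun h => ⟨V, Or.inr rfl, h⟩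
  have hopenC : ∀ {C : Set (ℝ × ℝ)}, (C = U ∨ C = V) → IsOpen C := by
    rintro C (rfl | rfl) <;> assumption
  obtain ⟨B, hB, hBmem⟩ := hends c ⟨le_rfl, hcd.le⟩ hy₀.1.ne
  obtain ⟨T, hT, hTmem⟩ := hends d ⟨hcd.le, le_rfl⟩ hy₀.2.ne'
  have hpre : ∀ {C : Set (ℝ × ℝ)} (s : ℝ), (C = U ∨ C = V) → IsOpen {x : ℝ | (x, s) ∈ C} :=
    fun s hC => (hopenC hC).preimage (by fun_prop : Continuous fun x : ℝ => (x, s))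
  -- Over `J` the lower and upper ends stay in `B` and `T`, each of which is `U` or `V`, and `X` is
  -- dense.
  set J : Set ℝ := interior (closure X) ∩ I ∩ {x | (x, c) ∈ B} ∩ {x | (x, d) ∈ T} with hJ
  have hJo : IsOpen J := ((isOpen_interior.inter hI).inter (hpre c hB)).inter (hpre d hT)
  have hJX : J ⊆ closure X := fun x hx => interior_subset hx.1.1.1
  have hx₀J : x₀ ∈ J := ⟨⟨⟨hx₀W, hx₀I⟩, hBmem⟩, hTmem⟩
  have hφ : Continuous fun x : ℝ => q * x + v.1 := by fun_prop
  have hψ : Continuous fun t : ℝ => (t - v.1) / q := by fun_prop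
  have hfst : ∀ p : ℝ × ℝ, (q • p + v) = ((q : ℝ) * p.1 + v.1, (q : ℝ) * p.2 + v.2) := fun p => by
    ext <;> simp [Rat.smul_def]
  rw [hfst] at hwall
  obtain ⟨n, hnJ, hn⟩ := exists_slit_of_mem_jumpWall hr (hJo.preimage hψ) hwall
    (by simpa [hqR] using hx₀J)
  obtain ⟨w, hw, hwΓ⟩ := hslit n
  -- The slit point pulled back along `p ↦ q • p + v`; it stays in `Γ`, so it lies in `U` or `V`.
  set s : ℝ := (w - v.2) / q with hs
  have hsΓ : ((r n - v.1) / q, s) ∈ Γ := by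
    have := Γ.smul_mem q⁻¹ (Γ.sub_mem hwΓ hv)
    convert this using 1
    ext <;> simp [Rat.smul_def, hs, div_eq_inv_mul]
  have hws : w = q * s + v.2 := by
    rw [hs]
    field_simp
    ring
  have hnI : (r n - v.1) / q ∈ I := hnJ.1.1.2
  obtain ⟨C, hC, hCmem⟩ : ∃ C : Set (ℝ × ℝ), (C = U ∨ C = V) ∧ ((r n - v.1) / q, s) ∈ C :=
    (hΓ _ hsΓ hnI).elim (fun h => ⟨U, Or.inl rfl, h⟩) fun h => ⟨V, Or.inr rfl, h⟩
  have side : ∀ (S : Set ℝ), IsOpen S → (𝓝[S] r n).NeBot → ∀ Q : ℝ → Prop,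
      (∀ᶠ t in 𝓝[S] r n, Q t) → ∃ x ∈ X, x ∈ J ∧ (x, s) ∈ C ∧ Q (q * x + v.1) := by
    intro S hSo hne Q hQ
    obtain ⟨O, hO, hnO, hOS⟩ := mem_nhdsWithin.1 hQ
    have hO2 : IsOpen {x | x ∈ J ∧ (x, s) ∈ C} := hJo.inter (hpre s hC)
    have hmem : O ∩ (fun t : ℝ => (t - v.1) / q) ⁻¹' {x | x ∈ J ∧ (x, s) ∈ C} ∈ 𝓝 (r n) :=
      inter_mem (hO.mem_nhds hnO) ((hO2.preimage hψ).mem_nhds ⟨hnJ, hCmem⟩)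
    obtain ⟨t, ⟨htO, htJ⟩, htS⟩ := hne.nonempty_of_mem
      (inter_mem (mem_nhdsWithin_of_mem_nhds hmem) self_mem_nhdsWithin)
    have hopen : IsOpen ({x | x ∈ J ∧ (x, s) ∈ C} ∩ (fun x : ℝ => q * x + v.1) ⁻¹' (O ∩ S)) :=
      hO2.inter ((hO.inter hSo).preimage hφ)
    have htφ : q * ((t - v.1) / q) + v.1 = t := by field_simp; ring
    obtain ⟨x, ⟨⟨hxJ, hxC⟩, hxOS⟩, hxX⟩ := mem_closure_iff.1 (hJX htJ.1) _ hopen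
      ⟨htJ, by simpa only [mem_preimage, htφ] using ⟨htO, htS⟩⟩
    exact ⟨x, hxX, hxJ, hxC, hOS hxOS⟩
  obtain ⟨hleft, hright⟩ := slit_separates hn hw
  obtain ⟨x₁, ⟨y₁, hy₁, ⟨-, hw₁⟩, hgap₁⟩, hx₁J, hx₁C, hQ₁⟩ := side _ isOpen_Iio inferInstance _ hleft
  obtain ⟨x₂, ⟨y₂, hy₂, ⟨-, hw₂⟩, hgap₂⟩, hx₂J, hx₂C, hQ₂⟩ := side _ isOpen_Ioi inferInstance _ hright
  rw [hfst] at hw₁ hw₂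
  have h₁ := hQ₁ _ hw₁
  have h₂ := hQ₂ _ hw₂
  have hgapC : ∀ {x y : ℝ}, {s | (x, s) ∉ U ∪ V} ∩ Icc c d = {y} → y ∈ Ioo c d →
      s ∈ Icc c d → x ∈ J → (x, s) ∈ C → (s < y → B = C) ∧ (y < s → T = C) := by
    intro x y hgap hy hscd hxJ hxC
    have hxB : (x, c) ∈ B := hxJ.1.2
    have hxT : (x, d) ∈ T := hxJ.2
    have hgap' : {s | (x, s) ∉ V ∪ U} ∩ Icc c d = {y} := by rwa [union_comm]
    have hU' := mem_left_of_uniqueGap hU hV hUV hgap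
    have hV' := mem_left_of_uniqueGap hV hU hUV.symm hgap'
    have hdisj := disjoint_left.1 hUV
    constructor
    · intro hsy
      have hs' : s ∈ Ico c y := ⟨hscd.1, hsy⟩
      have hc' : c ∈ Ico c y := ⟨le_rfl, hy.1⟩
      rcases hC with rfl | rfl <;> rcases hB with rfl | rfl
      · rfl
      · exact (hdisj (hU'.2 s hs' hxC c hc') hxB).elim
      · exact (hdisj hxB (hV'.2 s hs' hxC c hc')).elim
      · rfl
    · intro hys
      have hs' : s ∈ Ioc y d := ⟨hys, hscd.2⟩
      have hd' : d ∈ Ioc y d := ⟨hy.2, le_rfl⟩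
      rcases hC with rfl | rfl <;> rcases hT with rfl | rfl
      · rfl
      · exact (hdisj (hU'.1 s hs' hxC d hd') hxT).elim
      · exact (hdisj hxT (hV'.1 s hs' hxC d hd')).elim
      · rfl
  -- On one side of the slit the gap point is above `s`, so the segment from `c` to `s` gives `B =
  -- C`; on the other it is below, giving `T = C`. The sign of `q` decides which side is which, and
  -- the two gap points bracket `s` within [c, d].
  have hBT : B = C ∧ T = C := by
    rw [hws] at h₁ h₂
    rcases lt_or_gt_of_ne hqR with hneg | hpos
    · have h1 : y₁ < s := by nlinarith
      have h2 : s < y₂ := by nlinarith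
      have hscd : s ∈ Icc c d := ⟨(hy₁.1.trans h1).le, (h2.trans hy₂.2).le⟩
      exact ⟨(hgapC hgap₂ hy₂ hscd hx₂J hx₂C).1 h2, (hgapC hgap₁ hy₁ hscd hx₁J hx₁C).2 h1⟩
    · have h1 : s < y₁ := by nlinarith
      have h2 : y₂ < s := by nlinarith
      have hscd : s ∈ Icc c d := ⟨(hy₂.1.trans h2).le, (h1.trans hy₁.2).le⟩
      exact ⟨(hgapC hgap₁ hy₁ hscd hx₁J hx₁C).1 h1, (hgapC hgap₂ hy₂ hscd hx₂J hx₂C).2 h2⟩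
  -- The gap point must be a limit of both `U` and `V`, yet with both ends in `C` the other open set
  -- stays away from it.
  have hbd := hreg (x₀, y₀) hx₀I hy₀mem.1
  have hcJ : ∀ x ∈ J, (x, c) ∈ C := fun x hx => hBT.1 ▸ hx.1.2
  have hdJ : ∀ x ∈ J, (x, d) ∈ C := fun x hx => hBT.2 ▸ hx.2
  rcases hC with rfl | rfl
  · exact notMem_closure_of_dense_uniqueGap hU hV hUV hJo hJX hcJ hdJ hx₀J hy₀ hbd.2
  · refine notMem_closure_of_dense_uniqueGap hV hU hUV.symm hJo (P := {p | p.1 ∈ I ∧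
      q • p + v ∈ jumpWall r}) ?_ hcJ hdJ hx₀J hy₀ hbd.1
    simpa only [hX, uniqueGap, union_comm U] using hJX

end Separation

/-! ### Finding a usable point in a gap -/

/-- Over each abscissa, the affine copies of the wall given by a small group contain fewer than
continuum many points. -/
theorem mk_wall_copies_lt (r : ℕ → ℝ) {Γ : Submodule ℚ (ℝ × ℝ)} (hcard : #Γ < 𝔠) (x : ℝ) :
    #{y : ℝ | ∃ q : ℚ, q ≠ 0 ∧ ∃ v ∈ Γ, q • (x, y) + v ∈ jumpWall r} < 𝔠 := by
  have hι : #({q : ℚ // q ≠ 0} × Γ) < 𝔠 := by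
    rw [mk_prod, lift_id, lift_id]
    exact mul_lt_of_lt aleph0_le_continuum (mk_le_aleph0.trans_lt aleph0_lt_continuum) hcard
  refine (mk_le_mk_of_subset ?_).trans_lt (mk_iUnion_lt_continuum_of_countable hι
    (fun i => {y | i.1.1 • (x, y) + i.2.1 ∈ jumpWall r}) fun i => ?_)
  · rintro y ⟨q, hq, v, hv, h⟩
    exact mem_iUnion.2 ⟨(⟨q, hq⟩, ⟨v, hv⟩), h⟩
  · have hinj : Function.Injective fun y : ℝ => i.1.1 • y + i.2.1.2 :=
      fun y y' h => smul_right_injective ℝ i.1.2 (add_right_cancel h)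
    exact (countable_section_jumpWall r (i.1.1 • x + i.2.1.1)).preimage hinj

theorem exists_gap_point_of_subset_closure
    (hcov : ¬ ∃ 𝓜 : Set (Set ℝ), #𝓜 < 𝔠 ∧ (∀ A ∈ 𝓜, IsMeagre A) ∧ ⋃₀ 𝓜 = Set.univ)
    {r : ℕ → ℝ} (hr : DenseRange r) {Γ : Submodule ℚ (ℝ × ℝ)} (hcard : #Γ < 𝔠)
    (hslit : ∀ n, ∃ y ∈ slit r n, (r n, y) ∈ Γ) {a b : ℝ} {U V : Set (ℝ × ℝ)}
    (hU : IsOpen U) (hV : IsOpen V) (hUV : Disjoint U V)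
    (hreg : ∀ p : ℝ × ℝ, p.1 ∈ Ioo a b → p ∉ U ∪ V → p ∈ closure U ∧ p ∈ closure V)
    (hUne : ∃ p ∈ U, p.1 ∈ Ioo a b) (hVne : ∃ p ∈ V, p.1 ∈ Ioo a b)
    (hΓ : ∀ p ∈ Γ, p.1 ∈ Ioo a b → p ∈ U ∪ V) :
    ∃ p : ℝ × ℝ, p.1 ∈ Ioo a b ∧ p ∉ U ∪ V ∧ (∀ y, (p.1, y) ∉ Γ) ∧
      ∀ q : ℚ, q ≠ 0 → ∀ v ∈ Γ, q • p + v ∉ jumpWall r := by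
  by_contra! hcon
  have hsec : ∀ x : ℝ, Continuous fun y : ℝ => (x, y) := fun x => by fun_prop
  have hrow : ∀ y : ℝ, Continuous fun x : ℝ => (x, y) := fun y => by fun_prop
  have hsmall : ∀ x ∈ Ioo a b, (∀ y, (x, y) ∉ Γ) → #{y | (x, y) ∉ U ∪ V} < 𝔠 := by
    intro x hx hxΓ
    refine (mk_le_mk_of_subset fun y hy => ?_).trans_lt (mk_wall_copies_lt r hcard x)
    exact hcon (x, y) hx hy hxΓ
  have hempty : ∀ a' b' : ℝ, a' < b' → Ioo a' b' ⊆ Ioo a b →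
      ∃ x ∈ Ioo a' b', ∀ y, (x, y) ∈ U ∪ V := by
    intro a' b' hab' hsub
    -- Fewer than 𝔠 nowhere dense sets are to be avoided: the abscissae of `Γ`, and one `uniqueGap`
    -- for each copy of the wall and rational window.
    have hι : #(Γ ⊕ ({q : ℚ // q ≠ 0} × Γ) × ℚ × ℚ) < 𝔠 := by
      have hQ : ∀ (α : Type) [Countable α], #α < 𝔠 := fun α _ =>
        mk_le_aleph0.trans_lt aleph0_lt_continuum
      rw [mk_sum, lift_id, lift_id, mk_prod, lift_id, lift_id, mk_prod, lift_id, lift_id]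
      exact add_lt_of_lt aleph0_le_continuum hcard (mul_lt_of_lt aleph0_le_continuum
        (mul_lt_of_lt aleph0_le_continuum (hQ _) hcard) (hQ _))
    obtain ⟨x, hx, hxA⟩ := exists_mem_Ioo_forall_notMem_of_isNowhereDense hcov hι
      (Sum.elim (fun g => {g.1.1}) fun i => uniqueGap U V
        {p | p.1 ∈ Ioo a b ∧ i.1.1.1 • p + i.1.2.1 ∈ jumpWall r} i.2.1 i.2.2)
      (by
        rintro (g | i)
        · simp [IsNowhereDense]
        · exact isNowhereDense_uniqueGap hU hV hUV hr Γ hslit isOpen_Ioo hreg hΓ i.1.1.2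
            i.1.2.2 _ _) hab'
    refine ⟨x, hx, ?_⟩
    by_contra! hne
    have hxΓ : ∀ y, (x, y) ∉ Γ := fun y hy => hxA (Sum.inl ⟨(x, y), hy⟩) rfl
    have hclosed : IsClosed {y | (x, y) ∉ U ∪ V} := ((hU.union hV).preimage (hsec x)).isClosed_compl
    obtain ⟨y, hy, c, d, hcy, hyd, hgap⟩ :=
      hclosed.exists_isolated_of_mk_lt hne (hsmall x (hsub hx) hxΓ)
    obtain ⟨q, hq, v, hv, h⟩ := hcon (x, y) (hsub hx) hy hxΓ
    exact hxA (Sum.inr ((⟨q, hq⟩, ⟨v, hv⟩), c, d)) ⟨y, ⟨hcy, hyd⟩, ⟨hsub hx, h⟩, hgap⟩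
  have hfull : ∀ O : Set ℝ, IsOpen O → (O ∩ Ioo a b).Nonempty →
      ∃ x ∈ O ∩ Ioo a b, ∀ y, (x, y) ∈ U ∪ V := by
    rintro O hO ⟨x, hx⟩
    obtain ⟨l, u, hxlu, hlu⟩ := mem_nhds_iff_exists_Ioo_subset.1 ((hO.inter isOpen_Ioo).mem_nhds hx)
    obtain ⟨z, hz, h⟩ := hempty l u (hxlu.1.trans hxlu.2) (hlu.trans inter_subset_right)
    exact ⟨z, hlu hz, h⟩
  have hlineU : ∀ x y, (∀ y, (x, y) ∈ U ∪ V) → (x, y) ∈ U → ∀ y, (x, y) ∈ U :=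
    fun x y h hy z => vertical_subset_left hU hV hUV isPreconnected_univ (mem_univ y) hy
      (fun s _ => h s) (mem_univ z)
  have hlineV : ∀ x y, (∀ y, (x, y) ∈ U ∪ V) → (x, y) ∈ V → ∀ y, (x, y) ∈ V :=
    fun x y h hy z => vertical_subset_left hV hU hUV.symm isPreconnected_univ (mem_univ y) hy
      (fun s _ => (h s).symm) (mem_univ z)
  have hcover : Ioo a b ⊆ closure {x | ∀ y, (x, y) ∈ U} ∪ closure {x | ∀ y, (x, y) ∈ V} := by
    intro x hx
    rw [← closure_union, mem_closure_iff]
    intro O hO hxO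
    obtain ⟨z, hz, h⟩ := hfull O hO ⟨x, hxO, hx⟩
    exact ⟨z, hz.1, (h 0).imp (fun h' => hlineU z 0 h h') fun h' => hlineV z 0 h h'⟩
  have hmeetU : (Ioo a b ∩ closure {x | ∀ y, (x, y) ∈ U}).Nonempty := by
    obtain ⟨p, hpU, hp⟩ := hUne
    obtain ⟨z, hz, h⟩ := hfull _ (hU.preimage (hrow p.2)) ⟨p.1, hpU, hp⟩
    exact ⟨z, hz.2, subset_closure (hlineU z p.2 h hz.1)⟩
  have hmeetV : (Ioo a b ∩ closure {x | ∀ y, (x, y) ∈ V}).Nonempty := by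
    obtain ⟨p, hpV, hp⟩ := hVne
    obtain ⟨z, hz, h⟩ := hfull _ (hV.preimage (hrow p.2)) ⟨p.1, hpV, hp⟩
    exact ⟨z, hz.2, subset_closure (hlineV z p.2 h hz.1)⟩
  -- A common limit of abscissae of full `U`-lines and of full `V`-lines carries a vertical line
  -- entirely in the gap.
  obtain ⟨x, hx, hxU, hxV⟩ := isPreconnected_closed_iff.1 isPreconnected_Ioo _ _ isClosed_closure
    isClosed_closure hcover hmeetU hmeetV
  have hline : ∀ y, (x, y) ∉ U ∪ V := by
    rintro y (h | h)
    · obtain ⟨z, hzU, hzV⟩ := mem_closure_iff.1 hxV _ (hU.preimage (hrow y)) h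
      exact disjoint_left.1 hUV hzU (hzV y)
    · obtain ⟨z, hzV, hzU⟩ := mem_closure_iff.1 hxU _ (hV.preimage (hrow y)) h
      exact disjoint_left.1 hUV (hzU y) hzV
  have hxΓ : ∀ y, (x, y) ∉ Γ := fun y hy => hline y (hΓ _ hy hx)
  have huniv : {y | (x, y) ∉ U ∪ V} = Set.univ := eq_univ_of_forall hline
  have := hsmall x hx hxΓ
  rw [huniv, mk_univ, mk_real] at this
  exact this.false

/-- A closed set that separates the strip `(a, b) × ℝ` and misses a graph of size less than the
continuum with points in all slits contains a point that can be added to the graph. -/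
theorem exists_gap_point
    (hcov : ¬ ∃ 𝓜 : Set (Set ℝ), #𝓜 < 𝔠 ∧ (∀ A ∈ 𝓜, IsMeagre A) ∧ ⋃₀ 𝓜 = Set.univ)
    {r : ℕ → ℝ} (hr : DenseRange r) {Γ : Submodule ℚ (ℝ × ℝ)} (hcard : #Γ < 𝔠)
    (hslit : ∀ n, ∃ y ∈ slit r n, (r n, y) ∈ Γ) {a b : ℝ} {U V : Set (ℝ × ℝ)}
    (hU : IsOpen U) (hV : IsOpen V) (hUV : Disjoint U V)
    (hUne : ∃ p ∈ U, p.1 ∈ Ioo a b) (hVne : ∃ p ∈ V, p.1 ∈ Ioo a b)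
    (hΓ : ∀ p ∈ Γ, p.1 ∈ Ioo a b → p ∈ U ∪ V) :
    ∃ p : ℝ × ℝ, p.1 ∈ Ioo a b ∧ p ∉ U ∪ V ∧ (∀ y, (p.1, y) ∉ Γ) ∧
      ∀ q : ℚ, q ≠ 0 → ∀ v ∈ Γ, q • p + v ∉ jumpWall r := by
  -- Enlarging `V` to the exterior of `U`, and then `U` to the exterior of that, shrinks the gap to
  -- points in both closures.
  have hV' : V ⊆ (closure U)ᶜ := subset_compl_iff_disjoint_left.2 (hUV.closure_left hV)
  have hU' : U ⊆ (closure (closure U)ᶜ)ᶜ := subset_compl_iff_disjoint_left.2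
    ((disjoint_compl_left.mono_right subset_closure).closure_left hU)
  have hsub := union_subset_union hU' hV'
  have hreg : ∀ p : ℝ × ℝ, p.1 ∈ Ioo a b → p ∉ (closure (closure U)ᶜ)ᶜ ∪ (closure U)ᶜ →
      p ∈ closure (closure (closure U)ᶜ)ᶜ ∧ p ∈ closure (closure U)ᶜ := by
    intro p _ hpn
    simp only [mem_union, mem_compl_iff, not_or, not_not] at hpn
    exact ⟨closure_mono hU' hpn.2, hpn.1⟩
  obtain ⟨p, hp, hpUV, h⟩ := exists_gap_point_of_subset_closure hcov hr hcard hslit (a := a) (b := b)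
    (U := (closure (closure U)ᶜ)ᶜ) (V := (closure U)ᶜ) isClosed_closure.isOpen_compl
    isClosed_closure.isOpen_compl (disjoint_compl_left.mono_right subset_closure)
    hreg (hUne.imp fun p hp => ⟨hU' hp.1, hp.2⟩)
    (hVne.imp fun p hp => ⟨hV' hp.1, hp.2⟩) fun p hp hpI => hsub (hΓ p hp hpI)
  exact ⟨p, hp, fun hpn => hpUV (hsub hpn), h⟩

/-! ### Admissible extensions -/

/-- The points that a graph through the origin missing the wall may contain. -/
def admissible (r : ℕ → ℝ) : Set (ℝ × ℝ) := {p | p ∉ jumpWall r ∧ (p.1 = 0 → p.2 = 0)}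

/-- If `q • z + v` with `q ≠ 0` had abscissa 0, then `-q⁻¹ • v` would be a point of `Γ` over `z.1`.
-/
theorem sup_span_singleton_subset_admissible {r : ℕ → ℝ} {Γ : Submodule ℚ (ℝ × ℝ)}
    (hΓ : (Γ : Set (ℝ × ℝ)) ⊆ admissible r) {z : ℝ × ℝ} (hz : ∀ y, (z.1, y) ∉ Γ)
    (hwall : ∀ q : ℚ, q ≠ 0 → ∀ v ∈ Γ, q • z + v ∉ jumpWall r) :
    ((Γ ⊔ Submodule.span ℚ {z} : Submodule ℚ (ℝ × ℝ)) : Set (ℝ × ℝ)) ⊆ admissible r := by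
  intro w hw
  obtain ⟨v, hv, u, hu, rfl⟩ := Submodule.mem_sup.1 hw
  obtain ⟨q, rfl⟩ := Submodule.mem_span_singleton.1 hu
  rcases eq_or_ne q 0 with rfl | hq
  · simpa using hΓ hv
  · refine ⟨by simpa only [add_comm] using hwall q hq v hv, fun h => ?_⟩
    refine (hz (-q⁻¹ • v).2 ?_).elim
    have h1 : v.1 = -(q • z.1) := eq_neg_of_add_eq_zero_left h
    have h2 : (z.1, (-q⁻¹ • v).2) = -q⁻¹ • v := by
      ext
      · simp [h1, smul_smul, hq]
      · rfl
    rw [h2]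
    exact Γ.smul_mem _ hv

/-- A graph can be extended over any given abscissa, with a height from any given large set. -/
theorem exists_vertical_extension {r : ℕ → ℝ} {Γ : Submodule ℚ (ℝ × ℝ)} (hcard : #Γ < 𝔠)
    (hΓ : (Γ : Set (ℝ × ℝ)) ⊆ admissible r) {x : ℝ} (hx : ∀ y, (x, y) ∉ Γ) {S : Set ℝ}
    (hS : #S = 𝔠) :
    ∃ y ∈ S, ((Γ ⊔ Submodule.span ℚ {(x, y)} : Submodule ℚ (ℝ × ℝ)) : Set (ℝ × ℝ))
      ⊆ admissible r := by
  have hnot : ¬ S ⊆ {y : ℝ | ∃ q : ℚ, q ≠ 0 ∧ ∃ v ∈ Γ, q • (x, y) + v ∈ jumpWall r} := fun h =>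
    ((mk_le_mk_of_subset h).trans_lt (mk_wall_copies_lt r hcard x)).ne hS
  obtain ⟨y, hy, hyK⟩ := not_subset.1 hnot
  exact ⟨y, hy, sup_span_singleton_subset_admissible hΓ hx fun q hq v hv h =>
    hyK ⟨q, hq, v, hv, h⟩⟩

/-- There is an admissible countably generated graph with points in all slits. -/
theorem exists_graph_meeting_slits {r : ℕ → ℝ} (hr : DenseRange r)
    (hli : LinearIndependent ℚ r) :
    ∃ Γ : Submodule ℚ (ℝ × ℝ), #Γ < 𝔠 ∧ (Γ : Set (ℝ × ℝ)) ⊆ admissible r ∧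
      ∀ n, ∃ y ∈ slit r n, (r n, y) ∈ Γ := by
  have hbot : #(⊥ : Submodule ℚ (ℝ × ℝ)) < 𝔠 :=
    (mk_lt_aleph0 (α := (⊥ : Submodule ℚ (ℝ × ℝ)))).trans aleph0_lt_continuum
  have hcount : ∀ S : Set (ℝ × ℝ), S.Countable →
      #(⊥ ⊔ Submodule.span ℚ S : Submodule ℚ (ℝ × ℝ)) < 𝔠 := fun S hS =>
    Submodule.mk_sup_rat_lt _ _ aleph0_lt_continuum hbot
      ((le_aleph0_iff_set_countable.2 hS).trans_lt aleph0_lt_continuum)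
  obtain ⟨p, hp, hA⟩ := Submodule.exists_transfinite_generators (R := ℚ) (admissible r) ⊥
    (fun n => {p | p.1 = r n ∧ p.2 ∈ slit r n})
    (by
      rintro z hz
      rw [SetLike.mem_coe, Submodule.mem_bot] at hz
      subst hz
      exact ⟨zero_notMem_jumpWall hr, fun _ => rfl⟩)
    (by
      intro n p hp hA
      -- Projecting to abscissae would put `r n` in the span of the earlier `r j`.
      have hx : ∀ y, (r n, y) ∉ ⊥ ⊔ Submodule.span ℚ (p '' Iio n) := by
        intro y hy
        rw [bot_sup_eq] at hy
        have h := Submodule.mem_map_of_mem (f := LinearMap.fst ℚ ℝ ℝ) hy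
        have himg : (fun j => LinearMap.fst ℚ ℝ ℝ (p j)) '' Iio n = r '' Iio n :=
          image_congr fun j hj => (hp j hj).1
        rw [Submodule.map_span, image_image, himg] at h
        exact hli.notMem_span_image (s := Iio n) (lt_irrefl n) h
      obtain ⟨y, hy, h⟩ := exists_vertical_extension
        (hcount _ ((Set.to_countable (Iio n)).image p)) hA hx (mk_slit r n)
      exact ⟨(r n, y), ⟨rfl, hy⟩, h⟩)
  refine ⟨_, hcount _ (countable_range p), hA, fun n => ⟨(p n).2, (hp n).2, ?_⟩⟩
  rw [← (hp n).1]
  exact Submodule.mem_sup_right (Submodule.subset_span (mem_range_self n))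

/-! ### Strip gaps and the recursion of length 𝔠 -/

/-- The complement, in a vertical open strip, of the union of two disjoint open sets that both meet
the strip. -/
def IsStripGap (F : Set (ℝ × ℝ)) : Prop :=
  ∃ (a b : ℝ) (U V : Set (ℝ × ℝ)), IsOpen U ∧ IsOpen V ∧ Disjoint U V ∧
    (∃ p ∈ U, p.1 ∈ Ioo a b) ∧ (∃ p ∈ V, p.1 ∈ Ioo a b) ∧ F = {p | p.1 ∈ Ioo a b ∧ p ∉ U ∪ V}

theorem IsStripGap.measurableSet {F : Set (ℝ × ℝ)} (hF : IsStripGap F) : MeasurableSet F := by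
  obtain ⟨a, b, U, V, hU, hV, -, -, -, rfl⟩ := hF
  exact (measurableSet_Ioo.preimage measurable_fst).inter
    (hU.union hV).measurableSet.compl

/-- Gaps are Borel, and a countably generated σ-algebra has at most 𝔠 members; this lets one
recursion of length 𝔠 serve them all. -/
theorem mk_isStripGap_le : #{F // IsStripGap F} ≤ 𝔠 := by
  have hb := TopologicalSpace.isBasis_countableBasis (ℝ × ℝ)
  have h := MeasurableSpace.cardinal_measurableSet_le_continuum
    (s := TopologicalSpace.countableBasis (ℝ × ℝ)) ((le_aleph0_iff_set_countable.2
      (TopologicalSpace.countable_countableBasis _)).trans aleph0_le_continuum)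
  refine (mk_le_mk_of_subset (s := {F | IsStripGap F}) fun F hF => ?_).trans h
  have := hF.measurableSet
  rwa [BorelSpace.measurable_eq (α := ℝ × ℝ), hb.borel_eq_generateFrom] at this

/-- A full admissible graph that meets all gaps. -/
theorem exists_graph_meeting_gaps
    (hcov : ¬ ∃ 𝓜 : Set (Set ℝ), #𝓜 < 𝔠 ∧ (∀ A ∈ 𝓜, IsMeagre A) ∧ ⋃₀ 𝓜 = Set.univ)
    {r : ℕ → ℝ} (hr : DenseRange r) (hli : LinearIndependent ℚ r) :
    ∃ Γ : Submodule ℚ (ℝ × ℝ), (Γ : Set (ℝ × ℝ)) ⊆ admissible r ∧ (∀ x, ∃ y, (x, y) ∈ Γ) ∧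
      ∀ F, IsStripGap F → ∃ p ∈ Γ, p ∈ F := by
  obtain ⟨Γ₀, hΓ₀card, hΓ₀, hslit⟩ := exists_graph_meeting_slits hr hli
  -- The initial ordinal of 𝔠: fewer than 𝔠 stages precede each stage.
  let ι := (𝔠 : Cardinal.{0}).ord.ToType
  have hT : #(ℝ ⊕ {F // IsStripGap F}) ≤ #ι := by
    rw [mk_sum, lift_id, lift_id, mk_real, mk_ord_toType]
    exact (add_le_add_right mk_isStripGap_le 𝔠).trans_eq continuum_add_self
  obtain ⟨e⟩ := hT
  let task : ι → ℝ ⊕ {F // IsStripGap F} := Function.invFun e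
  have htask : Function.Surjective task := Function.invFun_surjective e.injective
  let D : ℝ ⊕ {F // IsStripGap F} → Set (ℝ × ℝ) := Sum.elim (fun x => {p | p.1 = x}) Subtype.val
  obtain ⟨p, hp, hA⟩ := Submodule.exists_transfinite_generators (R := ℚ) (admissible r) Γ₀
    (fun i => D (task i)) hΓ₀ (by
      intro i p _ hA
      set Γ := Γ₀ ⊔ Submodule.span ℚ (p '' Iio i) with hΓ
      have hcard : #Γ < 𝔠 := Submodule.mk_sup_rat_lt _ _ aleph0_lt_continuum hΓ₀card
        (mk_image_le.trans_lt ((mk_Iio_lt i (by simp [ι])).trans_eq (mk_ord_toType _)))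
      have hold : ∀ z ∈ Γ, Γ ⊔ Submodule.span ℚ {z} = Γ := fun z hz =>
        sup_eq_left.2 ((Submodule.span_singleton_le_iff_mem _ _).2 hz)
      -- A task that is already met is served by a point of `Γ`, which changes nothing.
      by_cases hmeet : ∃ z ∈ Γ, z ∈ D (task i)
      · obtain ⟨z, hz, hzD⟩ := hmeet
        exact ⟨z, hzD, by rwa [hold z hz]⟩
      rcases htaski : task i with x | ⟨F, hF⟩
      · rw [htaski] at hmeet
        obtain ⟨y, -, h⟩ := exists_vertical_extension hcard hA (x := x) (S := Set.univ)
          (fun y hy => hmeet ⟨(x, y), hy, rfl⟩) (by rw [mk_univ, mk_real])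
        exact ⟨(x, y), rfl, h⟩
      · rw [htaski] at hmeet
        obtain ⟨a, b, U, V, hU, hV, hUV, hUne, hVne, rfl⟩ := hF
        obtain ⟨z, hz, hzUV, hzΓ, hzK⟩ := exists_gap_point hcov hr hcard
          (fun n => (hslit n).imp fun y hy => ⟨hy.1, Submodule.mem_sup_left hy.2⟩) hU hV hUV
          hUne hVne fun z hz hzI => by
            by_contra h
            exact hmeet ⟨z, hz, hzI, h⟩
        exact ⟨z, ⟨hz, hzUV⟩, sup_span_singleton_subset_admissible hA hzΓ hzK⟩)
  have hmem : ∀ t, ∃ z ∈ Γ₀ ⊔ Submodule.span ℚ (range p), z ∈ D t := fun t => by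
    obtain ⟨i, rfl⟩ := htask t
    exact ⟨p i, Submodule.mem_sup_right (Submodule.subset_span (mem_range_self i)), hp i⟩
  refine ⟨_, hA, fun x => ?_, fun F hF => hmem (Sum.inr ⟨F, hF⟩)⟩
  obtain ⟨⟨x', y⟩, hz, hzx : x' = x⟩ := hmem (Sum.inl x)
  exact ⟨y, hzx ▸ hz⟩

/-! ### From meeting gaps to connectivity -/

section Connectivity

variable {f : ℝ → ℝ}

/-- A graph that meets all gaps is dense over every interval. -/
theorem mem_closure_graphOn_Ioo (hf : ∀ F, IsStripGap F → ∃ x, (x, f x) ∈ F) {a b : ℝ}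
    (hab : a < b) {p : ℝ × ℝ} (hp : p.1 ∈ Icc a b) : p ∈ closure ((Ioo a b).graphOn f) := by
  rw [mem_closure_iff]
  intro O hO hpO
  have hpcl : p ∈ closure (Ioo a b ×ˢ (Set.univ : Set ℝ)) := by
    rw [closure_prod_eq, closure_Ioo hab.ne, closure_univ]
    exact ⟨hp, mem_univ _⟩
  obtain ⟨c, hcO, hc⟩ := mem_closure_iff.1 hpcl O hO hpO
  obtain ⟨ε, hε, hball⟩ := Metric.isOpen_iff.1 (hO.inter (isOpen_Ioo.prod isOpen_univ)) c ⟨hcO, hc⟩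
  -- The gap between a small ball and the exterior of its closure lies inside the given open set.
  obtain ⟨x, hx, hxUV⟩ := hf _ ⟨a, b, Metric.ball c (ε / 2), (Metric.closedBall c (ε / 2))ᶜ,
    Metric.isOpen_ball, Metric.isClosed_closedBall.isOpen_compl,
    disjoint_compl_right.mono_left Metric.ball_subset_closedBall,
    ⟨c, Metric.mem_ball_self (half_pos hε), hc.1⟩,
    ⟨(c.1, c.2 + ε), by
      rw [mem_compl_iff, Metric.mem_closedBall, Prod.dist_eq, not_le]
      refine lt_max_of_lt_right ?_
      rw [Real.dist_eq]
      simp only [add_sub_cancel_left, abs_of_pos hε]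
      linarith, hc.1⟩, rfl⟩
  have hxc : (x, f x) ∈ Metric.closedBall c (ε / 2) := by
    by_contra h
    exact hxUV (Or.inr h)
  have := hball (Metric.closedBall_subset_ball (half_lt_self hε) hxc)
  exact ⟨(x, f x), this.1, x, hx, rfl⟩

/-- If `u` and `v` separated the graph, density of the graph would make them disjoint in the strip,
and the graph would meet the gap they leave. -/
theorem isPreconnected_graphOn_Ioo (hf : ∀ F, IsStripGap F → ∃ x, (x, f x) ∈ F) (a b : ℝ) :
    IsPreconnected ((Ioo a b).graphOn f) := by
  rintro u v hu hv huv ⟨_, ⟨x, hx, rfl⟩, hxu⟩ ⟨_, ⟨y, hy, rfl⟩, hyv⟩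
  by_contra hne
  have hopen : ∀ {w : Set (ℝ × ℝ)}, IsOpen w → IsOpen (w ∩ Prod.fst ⁻¹' Ioo a b) := fun hw =>
    hw.inter (isOpen_Ioo.preimage continuous_fst)
  obtain ⟨z, hz, hzUV⟩ := hf _ ⟨a, b, u ∩ Prod.fst ⁻¹' Ioo a b, v ∩ Prod.fst ⁻¹' Ioo a b,
    hopen hu, hopen hv, disjoint_left.2 fun p hpu hpv => by
      obtain ⟨z, ⟨hzu, hzv⟩, hz⟩ := mem_closure_iff.1 (mem_closure_graphOn_Ioo hf
        (hx.1.trans hx.2) (Ioo_subset_Icc_self hpu.2)) (u ∩ v) (hu.inter hv) ⟨hpu.1, hpv.1⟩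
      exact hne ⟨z, hz, hzu, hzv⟩,
    ⟨_, ⟨hxu, hx⟩, hx⟩, ⟨_, ⟨hyv, hy⟩, hy⟩, rfl⟩
  exact hzUV ((huv (mem_image_of_mem _ hz)).imp (fun h => ⟨h, hz⟩) fun h => ⟨h, hz⟩)

/-- The graph over [x, y] lies between the graph over (x, y) and its closure; such pieces join any
two points. -/
theorem isConnectivityFunction_of_meets_gaps (hf : ∀ F, IsStripGap F → ∃ x, (x, f x) ∈ F) :
    IsConnectivityFunction f := by
  intro Z hZ
  have hIcc : ∀ {x y : ℝ}, x < y → IsPreconnected ((Icc x y).graphOn f) := fun hxy =>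
    (isPreconnected_graphOn_Ioo hf _ _).subset_closure (image_mono Ioo_subset_Icc_self) (by
      rintro _ ⟨z, hz, rfl⟩
      exact mem_closure_graphOn_Ioo hf hxy hz)
  have hsub : ∀ {x y : ℝ}, x ∈ Z → y ∈ Z → (Icc x y).graphOn f ⊆ Z.graphOn f := fun hx hy =>
    image_mono (hZ.ordConnected.out hx hy)
  refine isPreconnected_of_forall_pair ?_
  rintro _ ⟨x, hx, rfl⟩ _ ⟨y, hy, rfl⟩
  rcases lt_trichotomy x y with h | rfl | h
  · exact ⟨_, hsub hx hy, ⟨x, ⟨le_rfl, h.le⟩, rfl⟩, ⟨y, ⟨h.le, le_rfl⟩, rfl⟩, hIcc h⟩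
  · exact ⟨{(x, f x)}, singleton_subset_iff.2 ⟨x, hx, rfl⟩, rfl, rfl, isPreconnected_singleton⟩
  · exact ⟨_, hsub hy hx, ⟨x, ⟨h.le, le_rfl⟩, rfl⟩, ⟨y, ⟨le_rfl, h.le⟩, rfl⟩, hIcc h⟩

end Connectivity

end

theorem mainTheorem6
    (hcov : ¬ ∃ 𝓜 : Set (Set ℝ), #𝓜 < 𝔠 ∧ (∀ A ∈ 𝓜, IsMeagre A) ∧ ⋃₀ 𝓜 = univ) :
    ∃ f : ℝ → ℝ,
      IsAdditiveFunction f ∧ IsConnectivityFunction f ∧ ¬ IsAlmostContinuous f := by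
  obtain ⟨r, hr, hli⟩ := exists_denseRange_linearIndependent_rat
  obtain ⟨Γ, hΓ, htotal, hgap⟩ := exists_graph_meeting_gaps hcov hr hli
  -- Admissibility allows only the origin over abscissa 0, so the subspace is single-valued.
  have huniq : ∀ {x y y' : ℝ}, (x, y) ∈ Γ → (x, y') ∈ Γ → y = y' := fun h h' =>
    sub_eq_zero.1 ((hΓ (Γ.sub_mem h h')).2 (sub_self _))
  choose f hf using htotal
  refine ⟨f, fun x y => huniq (hf (x + y)) (Γ.add_mem (hf x) (hf y)),
    isConnectivityFunction_of_meets_gaps fun F hF => ?_, fun hac => ?_⟩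
  · obtain ⟨p, hpΓ, hpF⟩ := hgap F hF
    refine ⟨p.1, ?_⟩
    rwa [huniq (hf p.1) hpΓ]
  · obtain ⟨g, hg, hgK⟩ := hac (jumpWall r)ᶜ (isClosed_jumpWall r).isOpen_compl (by
      rintro _ ⟨x, -, rfl⟩
      exact (hΓ (hf x)).1)
    obtain ⟨t, ht⟩ := exists_graph_mem_jumpWall r hg
    exact hgK ⟨t, mem_univ t, rfl⟩ ht
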